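/- Let $G$ be a finite group and let $H$ be a subgroup of $G$. Put $\eta_H=\frac1{|H|}\sum_{h\in H}h\in\mathbb{C}[G]$, regard $\mathbb{C}[H]$ as a subalgebra of $\mathbb{C}[G]$, and let $E^\bullet(H)$ be the set of elements $e\in\mathbb{C}[H]$ such that $e^2=e$ and $\eta_He=\eta_H$. For $e\in E^\bullet(H)$ let $$\Theta(e)=\{w\in\mathbb{C}[G]:\ e\,w\,(1-e)=0\ \text{ and }\ (e-\eta_H)\,w\,\eta_H=0\}$$ be the weak lumping algebra of $e$. Let $\pi$ be the permutation character of $G$ acting on the set $G/H$ of left cosets of $H$. We say that $H$ has full induction restriction in $G$ if the restriction of $\pi$ to $H$ contains every irreducible complex character of $H$, that is, if $$\frac1{|H|}\sum_{h\in H}\overline{\chi(h)}\,\pi(h)\neq0\qquad\text{for every irreducible complex character }\chi\text{ of }H.$$ Proposition. The subgroup $H$ has full induction restriction in $G$ if and only if the union $\bigcup_{e\in E^\bullet(H)}\Theta(e)$ is irredundant, in the sense that for all $e,\tilde e\in E^\bullet(H)$, the containment $\Theta(e)\subseteq\Theta(\tilde e)$ implies that the left ideals $\mathbb{C}[G]e$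 and $\mathbb{C}[G]\tilde e$ are equal. -/

import Mathlib

noncomputable section

namespace WeakLumping

open scoped ComplexConjugate

/-- The complex group algebra `ℂ[G]`. -/
abbrev GroupAlg (G : Type*) [Group G] : Type _ := MonoidAlgebra ℂ G

/-- The element `η_H = |H|⁻¹ ∑_{h ∈ H} h` of `ℂ[G]`. -/
def eta {G : Type*} [Group G] (H : Subgroup G) : GroupAlg G :=
  (Nat.card H : ℂ)⁻¹ • ∑ᶠ h : H, MonoidAlgebra.of ℂ G (h : G)

/-- The group algebra `ℂ[H]` of a subgroup `H` of `G`, as a subalgebra of `ℂ[G]`: the image of the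
algebra homomorphism `ℂ[H] → ℂ[G]` induced by the inclusion `H → G`. -/
def subgroupAlg {G : Type*} [Group G] (H : Subgroup G) : Subalgebra ℂ (GroupAlg G) :=
  (MonoidAlgebra.mapDomainAlgHom ℂ ℂ H.subtype).range

/-- The set `E^•(H)` of idempotents `e` of `ℂ[H]` such that `η_H e = η_H`. -/
def idempotentsBullet {G : Type*} [Group G] (H : Subgroup G) : Set (GroupAlg G) :=
  {e | e ∈ subgroupAlg H ∧ IsIdempotentElem e ∧ eta H * e = eta H}

/-- The weak lumping algebra
`Θ(e) = {w ∈ ℂ[G] : e w (1 - e) = 0 and (e - η_H) w η_H = 0}`. -/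
def weakLumpingAlg {G : Type*} [Group G] (H : Subgroup G) (e : GroupAlg G) : Set (GroupAlg G) :=
  {w | e * w * (1 - e) = 0 ∧ (e - eta H) * w * eta H = 0}

/-- The union `Θ = ⋃_{e ∈ E^•(H)} Θ(e)` is irredundant: a containment `Θ(e) ⊆ Θ(e')` with
`e, e' ∈ E^•(H)` forces equality of the left ideals `ℂ[G]e = ℂ[G]e'`.
(`Ideal` means left ideal.) -/
def UnionIrredundant {G : Type*} [Group G] (H : Subgroup G) : Prop :=
  ∀ e ∈ idempotentsBullet H, ∀ e' ∈ idempotentsBullet H,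
    weakLumpingAlg H e ⊆ weakLumpingAlg H e' →
      (Ideal.span {e} : Ideal (GroupAlg G)) = Ideal.span {e'}

/-- `χ` is an irreducible complex character of the finite group `K`. An irreducible representation
of a finite group is finite-dimensional, so it may be taken on some `ℂⁿ`; `IsIrreducible` includes
that the representation is nonzero. -/
def IsIrreducibleCharacter {K : Type*} [Group K] (χ : K → ℂ) : Prop :=
  ∃ (n : ℕ) (ρ : Representation ℂ K (Fin n → ℂ)), ρ.IsIrreducible ∧ ρ.character = χ

/-- The inner product `⟨α, β⟩ = |K|⁻¹ ∑_{g ∈ K} conj (α g) β g` of functions on a finite group. -/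
def charInner {K : Type*} [Group K] (α β : K → ℂ) : ℂ :=
  (Nat.card K : ℂ)⁻¹ * ∑ᶠ g : K, conj (α g) * β g

/-- The permutation character of `G` acting on the set `G ⧸ H` of left cosets of `H`. -/
def permCharacter {G : Type*} [Group G] (H : Subgroup G) : G → ℂ :=
  (Representation.ofMulAction ℂ G (G ⧸ H)).character

/-- `H` has full induction restriction in `G`: the restriction to `H` of the permutation character
of `G` on `G ⧸ H` contains every irreducible character of `H`. -/
def FullInductionRestriction {G : Type*} [Group G] (H : Subgroup G) : Prop :=
  ∀ χ : H → ℂ, IsIrreducibleCharacter χ →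
    charInner χ (fun h : H => permCharacter H (h : G)) ≠ 0

end WeakLumping

end

/-! Both conditions say that `ℂ[G] η_H`, a copy of `ℂ[G ⧸ H]`, is faithful over `ℂ[H]`. By
semisimplicity a module is faithful iff it contains every simple module, which gives
`fullInductionRestriction_iff_left`. If it is faithful, test `Θ(e) ⊆ Θ(e')` on `(1 - e) a η_H` and
`η_H a (e - η_H)`: faithfulness on the left and on the right yields `e' = e' e` and `e = e e'`.
Conversely, the annihilator is generated by an idempotent `z`, and `Θ(1 - z) ⊆ Θ(1)`; irredundancy
forces `z = 0`. -/

noncomputable section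

open scoped MonoidAlgebra

/-! ### Faithful modules and irreducible constituents. -/

namespace Representation

/-- Every `k[K]`-module that is finite-dimensional over `k` is given by a representation on some
`kⁿ`. -/
theorem exists_asModule_equiv_fin {k K M : Type*} [Field k] [Group K] [AddCommGroup M] [Module k M]
    [Module k[K] M] [IsScalarTower k k[K] M] [FiniteDimensional k M] :
    ∃ (n : ℕ) (ρ : Representation k K (Fin n → k)), Nonempty (ρ.asModule ≃ₗ[k[K]] M) := by
  let e : M ≃ₗ[k] (Fin (Module.finrank k M) → k) := (Module.finBasis k M).equivFun
  let φ : k[K] →ₐ[k] Module.End k (Fin (Module.finrank k M) → k) :=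
    (e.conjAlgEquiv k).toAlgHom.comp (Algebra.lsmul k k M)
  let ρ : Representation k K (Fin (Module.finrank k M) → k) := (MonoidAlgebra.lift k _ K).symm φ
  have hρ : ρ.asAlgebraHom = φ := (MonoidAlgebra.lift k _ K).apply_symm_apply φ
  refine ⟨_, ρ, ⟨LinearEquiv.symm
    { toFun := fun m => ρ.asModuleEquiv.symm (e m)
      invFun := fun v => e.symm (ρ.asModuleEquiv v)
      left_inv := fun m => by simp
      right_inv := fun v => by simp
      map_add' := fun x y => by simp
      map_smul' := fun r x => ?_ }⟩⟩
  apply ρ.asModuleEquiv.injective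
  simp [hρ, φ]

/-- A finite-dimensional representation in characteristic not dividing the group order is faithful
for the group algebra if and only if every irreducible representation maps nontrivially to it. -/
theorem asAlgebraHom_injective_iff {k K V : Type*} [Field k] [Group K] [Finite K]
    [NeZero (Nat.card K : k)] [AddCommGroup V] [Module k V] (σ : Representation k K V) :
    Function.Injective σ.asAlgebraHom ↔
      ∀ (n : ℕ) (ρ : Representation k K (Fin n → k)), ρ.IsIrreducible →
        ∃ f : IntertwiningMap ρ σ, f ≠ 0 := by
  constructor
  · intro hσ n ρ hρ
    obtain ⟨I, ⟨e⟩⟩ := IsSemisimpleRing.exists_linearEquiv_ideal_of_isSimpleModule k[K] ρ.asModule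
    have : Nontrivial ρ.asModule := IsSimpleModule.nontrivial k[K] _
    obtain ⟨x, hx⟩ := exists_ne (0 : ρ.asModule)
    have hex : σ.asAlgebraHom (e x : k[K]) ≠ 0 := by
      rw [Ne, map_eq_zero_iff _ hσ]
      simpa using hx
    obtain ⟨v, hv⟩ : ∃ v, σ.asAlgebraHom (e x : k[K]) v ≠ 0 := by
      by_contra! h
      exact hex (LinearMap.ext h)
    -- Embed `ρ` in `k[K]` as a left ideal, then evaluate at `v`, which some element of that ideal
    -- does not kill.
    let F : ρ.asModule →ₗ[k[K]] σ.asModule :=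
      (LinearMap.toSpanSingleton k[K] σ.asModule (σ.asModuleEquiv.symm v)).comp
        (I.subtype.comp e.toLinearMap)
    refine ⟨(IntertwiningMap.equivLinearMapAsModule ρ σ).symm F, fun h => hv ?_⟩
    rw [LinearEquiv.map_eq_zero_iff] at h
    have := congrArg σ.asModuleEquiv (LinearMap.congr_fun h x)
    simpa [F] using this
  · intro h
    rw [injective_iff_map_eq_zero]
    intro b hb
    by_contra hb0
    -- `k[K]` is the sum of its simple left ideals, so `b * 1 ≠ 0` is detected on one of them.
    obtain ⟨S, hS, hbS⟩ : ∃ S : Ideal k[K], IsSimpleModule k[K] S ∧ ∃ s ∈ S, b * s ≠ 0 := by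
      by_contra! hc
      have h1 : (1 : k[K]) ∈ ⨆ S : {S : Ideal k[K] | IsSimpleModule k[K] S}, (S : Ideal k[K]) := by
        rw [← sSup_eq_iSup', IsSemisimpleModule.sSup_simples_eq_top]
        trivial
      refine hb0 ?_
      rw [← mul_one b]
      exact Submodule.iSup_induction _ (motive := fun x => b * x = 0) h1
        (fun S x hx => hc S S.2 x hx) (mul_zero b) (fun x y hx hy => by rw [mul_add, hx, hy, add_zero])
    obtain ⟨s, hs, hbs⟩ := hbS
    obtain ⟨n, ρ, ⟨e⟩⟩ := exists_asModule_equiv_fin (k := k) (K := K) (M := S)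
    have hρ : ρ.IsIrreducible := by
      rw [irreducible_iff_isSimpleModule_asModule]
      exact IsSimpleModule.congr e
    obtain ⟨f, hf⟩ := h n ρ hρ
    have hinj := (IsIrreducible.injective_or_eq_zero f).resolve_right hf
    let F := IntertwiningMap.equivLinearMapAsModule ρ σ f
    have hF : Function.Injective F := hinj
    apply hbs
    -- `S` embeds in `σ`, where `b` acts as zero.
    have : F (e.symm (b • ⟨s, hs⟩)) = 0 := by
      rw [map_smul, map_smul]
      apply σ.asModuleEquiv.injective
      simp [hb]
    rw [map_eq_zero_iff _ hF, LinearEquiv.map_eq_zero_iff] at this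
    simpa using congrArg Subtype.val this

/-- The permutation character counts fixed points. -/
theorem character_ofMulAction {k G X : Type*} [Field k] [Group G] [MulAction G X] [Finite X]
    (g : G) : (ofMulAction k G X).character g = Nat.card {x : X // g • x = x} := by
  classical
  have := Fintype.ofFinite X
  rw [character, LinearMap.trace_eq_matrix_trace k (MonoidAlgebra.basis X k), Matrix.trace]
  simp [LinearMap.toMatrix_apply, Fintype.card_subtype, MonoidAlgebra.basis, Finsupp.single_apply]

theorem character_ofMulAction_inv {k G X : Type*} [Field k] [Group G] [MulAction G X] [Finite X]
    (g : G) : (ofMulAction k G X).character g⁻¹ = (ofMulAction k G X).character g := by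
  simp only [character_ofMulAction, inv_smul_eq_iff, @eq_comm X _ (g • _)]

end Representation

/-! ### Full induction restriction as faithfulness. -/

namespace WeakLumping
open Representation ComplexConjugate

/-- For a real-valued, inversion-invariant character of `σ`, a nonzero inner product means that there
is a nonzero intertwining map. -/
theorem charInner_ne_zero_iff {K V W : Type*} [Group K] [Finite K] [AddCommGroup V] [Module ℂ V]
    [FiniteDimensional ℂ V] [AddCommGroup W] [Module ℂ W] [FiniteDimensional ℂ W]
    (ρ : Representation ℂ K V) (σ : Representation ℂ K W)
    (hconj : ∀ g, conj (σ.character g) = σ.character g)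
    (hinv : ∀ g, σ.character g⁻¹ = σ.character g) :
    charInner ρ.character σ.character ≠ 0 ↔ ∃ f : IntertwiningMap ρ σ, f ≠ 0 := by
  have := Fintype.ofFinite K
  have hK : (Nat.card K : ℂ) ≠ 0 := by simp
  have : Invertible (Nat.card K : ℂ) := invertibleOfNonzero hK
  -- Conjugating the whole sum frees the character of `ρ` from its conjugate, so `χ(g⁻¹) = conj
  -- χ(g)` is not needed for `ρ`.
  have key : conj (charInner ρ.character σ.character) =
      Module.finrank ℂ (IntertwiningMap ρ σ) := by
    rw [← card_inv_mul_sum_char_mul_char_eq_finrank, charInner, finsum_eq_sum_of_fintype,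
      ← Equiv.sum_comp (Equiv.inv K)]
    simp [hconj, hinv, mul_comm]
  have : FiniteDimensional ℂ (IntertwiningMap ρ σ) :=
    (invariantsEquivIntertwiningMap ρ σ).finiteDimensional
  rw [← map_ne_zero (starRingEnd ℂ), key, Nat.cast_ne_zero, ← Nat.pos_iff_ne_zero,
    Module.finrank_pos_iff_exists_ne_zero]

/-- Full induction restriction says that `ℂ[G ⧸ H]` is a faithful `ℂ[H]`-module. -/
theorem fullInductionRestriction_iff {G : Type*} [Group G] [Finite G] (H : Subgroup G) :
    FullInductionRestriction H ↔ Function.Injective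
      (asAlgebraHom ((ofMulAction ℂ G (G ⧸ H)).comp H.subtype)) := by
  set σ : Representation ℂ H _ := (ofMulAction ℂ G (G ⧸ H)).comp H.subtype
  have hσ : σ.character = fun h : H => permCharacter H (h : G) := rfl
  have : FiniteDimensional ℂ ℂ[G ⧸ H] := (MonoidAlgebra.basis (G ⧸ H) ℂ).finiteDimensional_of_finite
  have key (n : ℕ) (ρ : Representation ℂ H (Fin n → ℂ)) :=
    charInner_ne_zero_iff ρ σ (fun g => by simp [hσ, permCharacter, character_ofMulAction])
      (fun g => by simp [hσ, permCharacter, character_ofMulAction_inv])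
  rw [asAlgebraHom_injective_iff]
  constructor
  · exact fun h n ρ hρ => (key n ρ).1 (h _ ⟨n, ρ, hρ, rfl⟩)
  · rintro h _ ⟨n, ρ, hρ, rfl⟩
    exact (key n ρ).2 (h n ρ hρ)

end WeakLumping

/-! ### The inversion anti-automorphism. -/

namespace MonoidAlgebra

/-- The anti-automorphism of a group algebra that inverts group elements. -/
def invOp (k G : Type*) [CommSemiring k] [Group G] : k[G] →ₐ[k] k[G]ᵐᵒᵖ :=
  lift k _ G
    { toFun := fun g => MulOpposite.op (of k G g⁻¹)
      map_one' := by rw [inv_one, map_one, MulOpposite.op_one]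
      map_mul' := fun g h => by rw [← MulOpposite.op_mul, ← map_mul, mul_inv_rev] }

theorem invOp_of {k G : Type*} [CommSemiring k] [Group G] (g : G) :
    invOp k G (of k G g) = MulOpposite.op (of k G g⁻¹) :=
  lift_of _ _

theorem unop_invOp_unop_invOp {k G : Type*} [CommSemiring k] [Group G] (x : k[G]) :
    (invOp k G (invOp k G x).unop).unop = x := by
  induction x using MonoidAlgebra.induction_on with
  | of g => simp [invOp_of, -of_apply]
  | add x y hx hy => simp [hx, hy]
  | smul r x hx => simp [hx]

end MonoidAlgebra

/-! ### The idempotent `η_H` and the module `ℂ[G] η_H`. -/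

namespace WeakLumping
open MonoidAlgebra Representation

variable {G : Type*} [Group G] (H : Subgroup G)

theorem of_mem_subgroupAlg (h : H) : of ℂ G (h : G) ∈ subgroupAlg H :=
  ⟨of ℂ H h, by simp⟩

variable {H} in
theorem unop_invOp_mem_subgroupAlg {b : GroupAlg G} (hb : b ∈ subgroupAlg H) :
    (invOp ℂ G b).unop ∈ subgroupAlg H := by
  obtain ⟨c, rfl⟩ := (AlgHom.mem_range _).1 hb
  clear hb
  induction c using MonoidAlgebra.induction_on with
  | of h => simpa [invOp] using of_mem_subgroupAlg H h⁻¹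
  | add x y hx hy => simpa only [map_add, MulOpposite.unop_add] using add_mem hx hy
  | smul r x hx => simpa only [map_smul, MulOpposite.unop_smul] using Subalgebra.smul_mem _ hx r

section Finite
variable [Finite G]

theorem eta_mem_subgroupAlg : eta H ∈ subgroupAlg H := by
  have := Fintype.ofFinite H
  rw [eta, finsum_eq_sum_of_fintype]
  exact Subalgebra.smul_mem _ (Subalgebra.sum_mem _ fun h _ => of_mem_subgroupAlg H h) _

theorem of_mul_eta (h : H) : of ℂ G (h : G) * eta H = eta H := by
  have := Fintype.ofFinite H
  simp only [eta, finsum_eq_sum_of_fintype, mul_smul_comm, Finset.mul_sum, ← map_mul]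
  rw [← Equiv.sum_comp (Equiv.mulLeft h) (fun x : H => of ℂ G (x : G))]
  rfl

theorem eta_mul_of (h : H) : eta H * of ℂ G (h : G) = eta H := by
  have := Fintype.ofFinite H
  simp only [eta, finsum_eq_sum_of_fintype, smul_mul_assoc, Finset.sum_mul, ← map_mul]
  rw [← Equiv.sum_comp (Equiv.mulRight h) (fun x : H => of ℂ G (x : G))]
  rfl

variable {H} in
theorem commute_eta {b : GroupAlg G} (hb : b ∈ subgroupAlg H) : b * eta H = eta H * b := by
  obtain ⟨c, rfl⟩ := (AlgHom.mem_range _).1 hb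
  clear hb
  induction c using MonoidAlgebra.induction_on with
  | of h => simpa using (of_mul_eta H h).trans (eta_mul_of H h).symm
  | add x y hx hy => simp only [map_add, add_mul, mul_add, hx, hy]
  | smul r x hx => simp only [map_smul, smul_mul_assoc, mul_smul_comm, hx]

theorem eta_mul_eta : eta H * eta H = eta H := by
  have := Fintype.ofFinite H
  conv_lhs => enter [1]; rw [eta, finsum_eq_sum_of_fintype]
  simp only [smul_mul_assoc, Finset.sum_mul, of_mul_eta, Finset.sum_const, Finset.card_univ,
    Fintype.card_eq_nat_card, ← Nat.cast_smul_eq_nsmul ℂ, smul_smul]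
  rw [inv_mul_cancel₀ (by simp), one_smul]

theorem invOp_eta : invOp ℂ G (eta H) = MulOpposite.op (eta H) := by
  have := Fintype.ofFinite H
  apply MulOpposite.unop_injective
  simp only [eta, finsum_eq_sum_of_fintype, map_smul, map_sum, invOp_of, MulOpposite.unop_smul,
    Finset.unop_sum, MulOpposite.unop_op]
  rw [← Equiv.sum_comp (Equiv.inv H)]
  simp

/-- The action on `ℂ[G ⧸ H]` corresponds to left multiplication on `ℂ[G] η_H`. -/
theorem asAlgebraHom_eq_zero_iff (c : ℂ[H]) :
    asAlgebraHom ((ofMulAction ℂ G (G ⧸ H)).comp H.subtype) c = 0 ↔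
      ∀ a : GroupAlg G, mapDomainAlgHom ℂ ℂ H.subtype c * a * eta H = 0 := by
  set ι := mapDomainAlgHom ℂ ℂ H.subtype
  set σ : Representation ℂ H ℂ[G ⧸ H] := (ofMulAction ℂ G (G ⧸ H)).comp H.subtype
  let τ := ofMulAction ℂ G (G ⧸ H)
  let v : ℂ[G ⧸ H] := single ((1 : G) : G ⧸ H) 1
  let P : GroupAlg G →ₗ[ℂ] ℂ[G ⧸ H] := (LinearMap.applyₗ v).comp τ.asAlgebraHom.toLinearMap
  have hPof (g : G) : P (of ℂ G g) = single (g : G ⧸ H) 1 := by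
    simp [P, τ, v, -QuotientGroup.mk_one]
  have hPι (c : ℂ[H]) (a : GroupAlg G) : P (ι c * a) = asAlgebraHom σ c (P a) := by
    have h : (asAlgebraHom τ).comp ι = asAlgebraHom σ := by
      ext h : 2
      simp [ι, σ, τ]
    simp [P, ← h]
  -- The choice of coset representative is harmless because `h η_H = η_H` for `h ∈ H`.
  let Q : ℂ[G ⧸ H] →ₗ[ℂ] GroupAlg G := (MonoidAlgebra.basis (G ⧸ H) ℂ).constr ℂ
    (fun x => of ℂ G x.out * eta H)
  have hQP : ∀ a, Q (P a) = a * eta H := by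
    intro a
    induction a using MonoidAlgebra.induction_on with
    | of g =>
      obtain ⟨h, hh⟩ := QuotientGroup.mk_out_eq_mul H g
      have hb : (single (g : G ⧸ H) 1 : ℂ[G ⧸ H]) = MonoidAlgebra.basis (G ⧸ H) ℂ (g : G ⧸ H) := by
        simp [MonoidAlgebra.basis]
      rw [hPof, hb]
      simp only [Q, Module.Basis.constr_basis]
      rw [hh, map_mul, mul_assoc, of_mul_eta]
    | add x y hx hy => simp only [map_add, hx, hy, add_mul]
    | smul r x hx => simp only [map_smul, hx, smul_mul_assoc]
  have hPη (a : GroupAlg G) : P (a * eta H) = P a := by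
    have hη : P (eta H) = v := by
      have := Fintype.ofFinite H
      have hx (h : H) : ((h : G) : G ⧸ H) = (1 : G) := by simp [QuotientGroup.eq]
      rw [eta, finsum_eq_sum_of_fintype, map_smul, map_sum]
      simp only [hPof, hx, Finset.sum_const, Finset.card_univ, Fintype.card_eq_nat_card,
        ← Nat.cast_smul_eq_nsmul ℂ, smul_smul]
      rw [inv_mul_cancel₀ (by simp), one_smul]
    have hmul : P (a * eta H) = asAlgebraHom τ a (P (eta H)) := by simp [P]
    rw [hmul, hη]
    rfl
  constructor
  · intro hc a
    rw [← hQP, hPι, hc, LinearMap.zero_apply, map_zero]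
  · intro hc
    refine (MonoidAlgebra.basis (G ⧸ H) ℂ).ext fun x => ?_
    obtain ⟨g, rfl⟩ := QuotientGroup.mk_surjective x
    have hb : MonoidAlgebra.basis (G ⧸ H) ℂ (g : G ⧸ H) = P (of ℂ G g) := by
      rw [hPof]
      simp [MonoidAlgebra.basis]
    rw [hb, ← hPι, ← hPη, hc, map_zero, LinearMap.zero_apply]

/-- Full induction restriction says that `ℂ[G] η_H` is a faithful left `ℂ[H]`-module. -/
theorem fullInductionRestriction_iff_left :
    FullInductionRestriction H ↔
      ∀ b ∈ subgroupAlg H, (∀ a : GroupAlg G, b * a * eta H = 0) → b = 0 := by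
  rw [fullInductionRestriction_iff, injective_iff_map_eq_zero]
  have hι : Function.Injective (mapDomainAlgHom ℂ ℂ H.subtype) :=
    MonoidAlgebra.mapDomain_injective Subtype.val_injective
  constructor
  · rintro h b ⟨c, rfl⟩ hb
    exact (congrArg _ (h c ((asAlgebraHom_eq_zero_iff H c).2 hb))).trans (map_zero _)
  · intro h c hc
    exact (map_eq_zero_iff _ hι).1 (h _ ⟨c, rfl⟩ ((asAlgebraHom_eq_zero_iff H c).1 hc))

/-- Under full induction restriction, `η_H ℂ[G]` is a faithful right `ℂ[H]`-module. -/
theorem FullInductionRestriction.right {H : Subgroup G} (hH : FullInductionRestriction H)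
    {b : GroupAlg G} (hb : b ∈ subgroupAlg H) (h : ∀ a : GroupAlg G, eta H * a * b = 0) :
    b = 0 := by
  -- Inversion fixes `η_H` and reverses products, so it carries the right annihilation hypothesis to
  -- the left one.
  have h0 := (fullInductionRestriction_iff_left H).1 hH _ (unop_invOp_mem_subgroupAlg hb) fun a => by
    have := congrArg (fun x => (invOp ℂ G x).unop) (h (invOp ℂ G a).unop)
    simpa [invOp_eta, unop_invOp_unop_invOp, mul_assoc] using this
  rw [← unop_invOp_unop_invOp b, h0, map_zero, MulOpposite.unop_zero]

/-! ### The two implications. -/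

theorem FullInductionRestriction.unionIrredundant {H : Subgroup G}
    (hH : FullInductionRestriction H) : UnionIrredundant H := by
  rintro e ⟨heB, hee, hηe⟩ e' ⟨heB', hee', hηe'⟩ hsub
  have hηη := eta_mul_eta H
  have heη : e * eta H = eta H := (commute_eta heB).trans hηe
  have heη' : e' * eta H = eta H := (commute_eta heB').trans hηe'
  have h1 : e' = e' * e := by
    have : (e' - eta H) * (1 - e) = 0 := by
      refine (fullInductionRestriction_iff_left H).1 hH _ (mul_mem
        (sub_mem heB' (eta_mem_subgroupAlg H)) (sub_mem (one_mem _) heB)) fun a => ?_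
      -- Both `e` and `e - η_H` kill `1 - e` from the left.
      have hw : (1 - e) * a * eta H ∈ weakLumpingAlg H e := by
        constructor
        · simp [← mul_assoc, mul_sub, hee.eq]
        · simp [← mul_assoc, mul_sub, sub_mul, hee.eq, hηe]
      have := (hsub hw).2
      simpa only [mul_assoc, hηη] using this
    simpa [sub_mul, mul_sub, hηe, sub_eq_zero] using this
  have h2 : e = e * e' := by
    have : (e - eta H) * (1 - e') = 0 := by
      refine hH.right (mul_mem
        (sub_mem heB (eta_mem_subgroupAlg H)) (sub_mem (one_mem _) heB')) fun a => ?_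
      -- Both `1 - e` and `η_H` kill `e - η_H` from the right.
      have hw : eta H * a * (e - eta H) ∈ weakLumpingAlg H e := by
        constructor
        · simp [mul_assoc, mul_sub, sub_mul, hee.eq, hηe]
        · simp [mul_assoc, sub_mul, heη, hηη]
      -- Left multiplication by `η_H` absorbs the factor `e'`.
      have := congrArg (eta H * ·) (hsub hw).1
      simp only [← mul_assoc, hηe', hηη, mul_zero] at this
      simpa only [mul_assoc] using this
    simpa [sub_mul, mul_sub, hηe', sub_eq_zero] using this
  apply le_antisymm
  · rw [Ideal.span_singleton_le_iff_mem, Ideal.mem_span_singleton']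
    exact ⟨e, h2.symm⟩
  · rw [Ideal.span_singleton_le_iff_mem, Ideal.mem_span_singleton']
    exact ⟨e', h1.symm⟩

theorem UnionIrredundant.fullInductionRestriction {H : Subgroup G} (hH : UnionIrredundant H) :
    FullInductionRestriction H := by
  rw [fullInductionRestriction_iff_left]
  intro b hb hbη
  obtain ⟨c, rfl⟩ := (AlgHom.mem_range _).1 hb
  set ι := mapDomainAlgHom ℂ ℂ H.subtype
  let φ := asAlgebraHom ((ofMulAction ℂ G (G ⧸ H)).comp H.subtype)
  -- The kernel is the annihilator of `ℂ[G ⧸ H]`; showing `z = 0` makes it trivial.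
  obtain ⟨z, hz, hI⟩ := IsSemisimpleRing.ideal_eq_span_idempotent (RingHom.ker φ)
  have hzη : ∀ a : GroupAlg G, ι z * a * eta H = 0 :=
    (asAlgebraHom_eq_zero_iff H z).1 (by
      have : z ∈ RingHom.ker φ := hI ▸ Ideal.mem_span_singleton_self z
      exact this)
  have hzι : ι z ∈ subgroupAlg H := ⟨z, rfl⟩
  have hη1 : ι z * eta H = 0 := by simpa using hzη 1
  have hη2 : eta H * ι z = 0 := (commute_eta hzι).symm.trans hη1
  have hzz : ι z * ι z = ι z := by rw [← map_mul, hz.eq]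
  have hspan := hH (1 - ι z) ⟨sub_mem (one_mem _) hzι, IsIdempotentElem.one_sub hzz, by
      rw [mul_sub, mul_one, hη2, sub_zero]⟩ 1 ⟨one_mem _, IsIdempotentElem.one, mul_one _⟩ (by
    -- For the idempotent `1` the first condition is vacuous, and the second agrees with that for `1
    -- - z` since `z w η_H = 0`.
    rintro w ⟨-, hw⟩
    refine ⟨by simp, ?_⟩
    rw [← hw]
    simp only [sub_mul, hzη, sub_zero])
  have hz0 : ι z = 0 := by
    have h1 : (1 : GroupAlg G) ∈ (Ideal.span {1 - ι z} : Ideal (GroupAlg G)) :=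
      hspan ▸ Ideal.mem_span_singleton_self 1
    obtain ⟨a, ha⟩ := Ideal.mem_span_singleton'.1 h1
    rw [← one_mul (ι z), ← ha, mul_assoc, sub_mul, one_mul, hzz, sub_self, mul_zero]
  have hc : c ∈ RingHom.ker φ := (asAlgebraHom_eq_zero_iff H c).2 hbη
  rw [hI] at hc
  obtain ⟨a, rfl⟩ := Ideal.mem_span_singleton'.1 hc
  rw [map_mul, hz0, mul_zero]

end Finite
end WeakLumping
end

theorem proposition1p8 {G : Type*} [Group G] [Finite G] (H : Subgroup G) :
    WeakLumping.FullInductionRestriction H ↔ WeakLumping.UnionIrredundant H :=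
  ⟨fun h => h.unionIrredundant, fun h => h.fullInductionRestriction⟩
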